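/- **Theorem (error estimates for the mixed vorticity–velocity–pressure Stokes problem).** Let $n\ge 2$ and let $\Omega\subset\mathbb R^n$ be a bounded contractible domain with boundary $\Gamma=\partial\Omega$, decomposed in two ways, $\Gamma=\Gamma_\omega\sqcup\Gamma_t=\Gamma_n\sqcup\Gamma_\pi$. Write $(\cdot,\cdot)_\Omega$ for the $L^2$ inner product of differential forms, $H\Lambda^k(\Omega)=\{a\in L^2\Lambda^k(\Omega): \mathrm da\in L^2\Lambda^{k+1}(\Omega)\}$ with norm $\|a\|_{H\Lambda^k}^2=\|a\|_{L^2}^2+\|\mathrm da\|_{L^2}^2$, and $\mathrm d^*$ for the codifferential. Traces on parts of the boundary are understood weakly, through integration by parts. Let - $W=\{\tau\in H\Lambda^{n-2}(\Omega):\operatorname{tr}\tau=0\text{ on }\Gamma_\omega\}$; - $V=\{v\in H\Lambda^{n-1}(\Omega):\operatorname{tr}v=0\text{ on }\Gamma_n\}$; if $\Gamma_\omega\cap\Gamma_\pi\neq\emptyset$, then $V$ is this space modulo its elements $z$ with $\mathrm dz=0$ and $(\mathrm d\tau,z)_\Omega=0$ for all $\tau\in W$, the quotient being represented by the orthogonal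 complement; - $Q=L^2\Lambda^n(\Omega)$ if $\Gamma_\pi\ne\emptyset$, and $Q=L^2\Lambda^n(\Omega)$ modulo $\{q:\mathrm d^*q=0\}$ (the constants), again represented by the orthogonal complement, if $\Gamma_\pi=\emptyset$. The norms of $W$, $V$, $Q$ are those of $H\Lambda^{n-2}$, $H\Lambda^{n-1}$, $L^2\Lambda^n$. Put $\mathsf a(\tau,\kappa)=(\tau,\kappa)_\Omega$ and $\mathsf c(\tau,v)=(\mathrm d\tau,v)_\Omega$, $\mathsf e(v,w)=(\mathrm dv,\mathrm dw)_\Omega$, $\mathsf b(v,q)=(\mathrm dv,q)_\Omega$, and let $c_{\mathsf a},c_{\mathsf b},c_{\mathsf c},c_{\mathsf e}>0$ be continuity constants of these forms, i.e. $\mathsf a(\tau,\kappa)\le c_{\mathsf a}\|\tau\|_W\|\kappa\|_W$ on $W\times W$, $\mathsf b(v,q)\le c_{\mathsf b}\|v\|_V\|q\|_Q$ on $V\times Q$, $\mathsf c(\tau,v)\le c_{\mathsf c}\|\tau\|_W\|v\|_V$ on $W\times V$ and $\mathsf e(v,w)\le c_{\mathsf e}\|v\|_V\|w\|_V$ on $V\times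 V$. Let $f\in L^2\Lambda^{n-1}(\Omega)$, $g\in L^2\Lambda^n(\Omega)$, let $u_{b,t}$ on $\Gamma_t$ and $\Pi_b$ on $\Gamma_\pi$ be boundary data of the form $u_{b,t}=\operatorname{tr}\star\beta$, $\Pi_b=\operatorname{tr}\star\rho$ with $\beta\in L^2\Lambda^{n-1}(\Omega)$, $\mathrm d^*\beta\in L^2$ and $\rho\in L^2\Lambda^{n}(\Omega)$, $\mathrm d^*\rho\in L^2$ (this includes all data of class $H^{1/2}$), and put $$\mathsf f(v)=(v,f)_\Omega+\int_{\Gamma_\pi}\operatorname{tr}v\wedge\Pi_b,\qquad \mathsf g(q)=(q,g)_\Omega,\qquad \mathsf h(\tau)=-\int_{\Gamma_t}\operatorname{tr}\tau\wedge u_{b,t},$$ where, for $a\in W$ or $a\in V$ and $b=\beta$ or $b=\rho$ respectively, the boundary integral is $(\mathrm da,b)_\Omega-(a,\mathrm d^*b)_\Omega$. Let $(\omega,u,p)\in W\times V\times Q$ solve $$\mathsf a(\tau,\omega)-\mathsf c(\tau,u)=\mathsf h(\tau),\qquad \mathsf e(v,u)+\mathsf c(\omega,v)+\mathsf b(v,p)=\mathsf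 f(v),\qquad \mathsf b(u,q)=\mathsf g(q)$$ for all $(\tau,v,q)\in W\times V\times Q$. Let $W_h\subset W$, $V_h\subset V$, $Q_h\subset Q$ be finite-dimensional subspaces and let $(\omega_h,u_h,p_h)\in W_h\times V_h\times Q_h$ solve the same equations for all $(\tau,v,q)\in W_h\times V_h\times Q_h$. Put $Z_W=\{\tau\in W:\mathrm d\tau=0\}$, $Z_V=\{v\in V:\mathrm dv=0\}$, and $$Z_{V_h}=\{v\in V_h:\mathsf b(v,q)=0\ \forall q\in Q_h\},\qquad Z_{W_h}=\{\tau\in W_h:\mathsf c(\tau,v)=0\ \forall v\in Z_{V_h}\}.$$ Assume that the discretization is compatible: $Z_{W_h}\subset Z_W$, $Z_{V_h}\subset Z_V$ and $Q_h=\mathrm dV_h$. (The first two inclusions hold in particular whenever $\mathrm dW_h\subset V_h$ and $\mathrm dV_h=Q_h$; under them $Z_{W_h}$ and $Z_{V_h}$ are the null spaces of $\mathrm d$ in $W_h$ and $V_h$.) Let $\alpha_h,\beta_h,\gamma_h>0$ be constants with $$\inf_{\tau\in Z_{W_h}}\sup_{\kappa\in Z_{W_h}}\frac{\mathsf a(\tau,\kappa)}{\|\tau\|_W\|\kappa\|_W}\ge\alpha_h,\qquad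 \inf_{q\in Q_h}\sup_{v\in V_h}\frac{\mathsf b(v,q)}{\|v\|_V\|q\|_Q}\ge\beta_h,\qquad \inf_{v\in Z_{V_h}}\sup_{\tau\in W_h}\frac{\mathsf c(\tau,v)}{\|\tau\|_W\|v\|_V}\ge\gamma_h$$ (infima and suprema over nonzero elements). Then $$\|\omega-\omega_h\|_W\le\Big(1+\frac{c_{\mathsf a}}{\alpha_h}\Big)\Big(1+\frac{c_{\mathsf c}}{\gamma_h}\Big)\inf_{\tau_h\in W_h}\|\omega-\tau_h\|_W,$$ $$\|u-u_h\|_V\le\Big(1+\frac{c_{\mathsf c}}{\gamma_h}\Big)\Big(1+\frac{c_{\mathsf b}}{\beta_h}\Big)\inf_{v_h\in V_h}\|u-v_h\|_V+\frac{c_{\mathsf a}}{\gamma_h}\Big(1+\frac{c_{\mathsf a}}{\alpha_h}\Big)\Big(1+\frac{c_{\mathsf c}}{\gamma_h}\Big)\inf_{\tau_h\in W_h}\|\omega-\tau_h\|_W,$$ $$\|p-p_h\|_Q\le\Big(1+\frac{c_{\mathsf b}}{\beta_h}\Big)\inf_{q_h\in Q_h}\|p-q_h\|_Q+\frac{c_{\mathsf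 e}}{\beta_h}\Big(1+\frac{c_{\mathsf c}}{\gamma_h}\Big)\Big(1+\frac{c_{\mathsf b}}{\beta_h}\Big)\inf_{v_h\in V_h}\|u-v_h\|_V+\Big(\frac{c_{\mathsf a}}{\gamma_h}+\frac{c_{\mathsf c}}{\beta_h}\Big)\Big(1+\frac{c_{\mathsf a}}{\alpha_h}\Big)\Big(1+\frac{c_{\mathsf c}}{\gamma_h}\Big)\inf_{\tau_h\in W_h}\|\omega-\tau_h\|_W.$$ -/

import Mathlib

open MeasureTheory
open scoped InnerProductSpace

noncomputable section

namespace StokesVVP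

/-! ### Square-integrable differential forms in coordinates -/

/-- Multi-indices `i₁ < ⋯ < i_k` with entries in `{0, …, n - 1}`, encoded as `k`-element sets. -/
abbrev MultiIndex (n k : ℕ) : Type := {I : Finset (Fin n) // I.card = k}

/-- Values of `k`-forms on `ℝⁿ`: coefficient vectors `(f_I)_I` with respect to the forms
`dx^I = dx^{i₁} ∧ ⋯ ∧ dx^{i_k}`, which are orthonormal. -/
abbrev FormVal (n k : ℕ) : Type := EuclideanSpace ℝ (MultiIndex n k)

/-- The multi-index obtained by deleting an entry. -/
def MultiIndex.erase {n k : ℕ} (J : MultiIndex n (k + 1)) (j : {j // j ∈ J.1}) :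
    MultiIndex n k :=
  ⟨J.1.erase j.1, by rw [Finset.card_erase_of_mem j.2, J.2]; rfl⟩

/-- The multi-index obtained by adding an entry. -/
def MultiIndex.insert {n k : ℕ} (I : MultiIndex n k) (j : {j // j ∉ I.1}) :
    MultiIndex n (k + 1) :=
  ⟨Insert.insert j.1 I.1, by rw [Finset.card_insert_of_notMem j.2, I.2]⟩

/-- The sign `s` in `dx^j ∧ dx^{J ∖ j} = s dx^J`. -/
def wedgeSign {n k : ℕ} (j : Fin n) (J : MultiIndex n k) : ℝ :=
  (-1) ^ (J.1.filter (fun i => i < j)).card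

/-- The partial derivative `∂_j η_I` of a coefficient of a form. -/
def partialCoeff {n k : ℕ} (η : EuclideanSpace ℝ (Fin n) → FormVal n k)
    (j : Fin n) (I : MultiIndex n k) (x : EuclideanSpace ℝ (Fin n)) : ℝ :=
  (fderiv ℝ η x (EuclideanSpace.single j 1)) I

/-- The classical exterior derivative: `d (∑ f_I dx^I) = ∑_I ∑_j ∂_j f_I dx^j ∧ dx^I`. -/
def classicalD {n k : ℕ} (φ : EuclideanSpace ℝ (Fin n) → FormVal n k)
    (x : EuclideanSpace ℝ (Fin n)) : FormVal n (k + 1) :=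
  WithLp.toLp 2 fun J => ∑ j : {j // j ∈ J.1},
    wedgeSign j.1 J * partialCoeff φ j.1 (J.erase j) x

/-- The classical codifferential, the formal `L²`-adjoint of the exterior derivative. -/
def classicalCodiff {n k : ℕ} (η : EuclideanSpace ℝ (Fin n) → FormVal n (k + 1))
    (x : EuclideanSpace ℝ (Fin n)) : FormVal n k :=
  WithLp.toLp 2 fun I => -∑ j : {j // j ∉ I.1},
    wedgeSign j.1 (I.insert j) * partialCoeff η j.1 (I.insert j) x

/-- Smooth compactly supported forms on `ℝⁿ`. -/
def IsTestForm {n k : ℕ} (η : EuclideanSpace ℝ (Fin n) → FormVal n k) : Prop :=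
  ContDiff ℝ (⊤ : ℕ∞) η ∧ HasCompactSupport η

/-- `L²Λᵏ(Ω)`, with inner product `(a, b)_Ω = ∫_Ω ∑_I a_I b_I`. -/
abbrev L2Form {n : ℕ} (Ω : Set (EuclideanSpace ℝ (Fin n))) (k : ℕ) : Type :=
  Lp (FormVal n k) 2 (volume.restrict Ω)

/-- The integral `∫_Ω (a, η)` of an `L²`-form against a function with values in forms. -/
def testPairing {n k : ℕ} {Ω : Set (EuclideanSpace ℝ (Fin n))} (a : L2Form Ω k)
    (η : EuclideanSpace ℝ (Fin n) → FormVal n k) : ℝ :=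
  ∫ x in Ω, ⟪a x, η x⟫_ℝ

section helpers

variable {n k : ℕ}

lemma continuous_partialCoeff {η : EuclideanSpace ℝ (Fin n) → FormVal n k} (hη : IsTestForm η)
    (j : Fin n) (I : MultiIndex n k) : Continuous (partialCoeff η j I) := by
  have h : Continuous fun x => fderiv ℝ η x (EuclideanSpace.single j 1) :=
    (hη.1.continuous_fderiv (by simp)).clm_apply continuous_const
  exact (EuclideanSpace.proj I).continuous.comp h

lemma partialCoeff_eq_zero {η : EuclideanSpace ℝ (Fin n) → FormVal n k}
    {x : EuclideanSpace ℝ (Fin n)} (hx : x ∉ tsupport η) (j : Fin n) (I : MultiIndex n k) :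
    partialCoeff η j I x = 0 := by
  have h : fderiv ℝ η x = 0 := by
    by_contra h
    exact hx (support_fderiv_subset ℝ h)
  simp [partialCoeff, h]

lemma IsTestForm.codiff {η : EuclideanSpace ℝ (Fin n) → FormVal n (k + 1)} (hη : IsTestForm η) :
    Continuous (classicalCodiff η) ∧ HasCompactSupport (classicalCodiff η) := by
  refine ⟨?_, ?_⟩
  · refine (PiLp.continuous_toLp 2 _).comp (continuous_pi fun I => ?_)
    exact (continuous_finsetSum _ fun j _ =>
      continuous_const.mul (continuous_partialCoeff hη _ _)).neg
  · refine HasCompactSupport.intro hη.2 fun x hx => ?_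
    ext I
    simp [classicalCodiff, partialCoeff_eq_zero hx]

lemma IsTestForm.d {φ : EuclideanSpace ℝ (Fin n) → FormVal n k} (hφ : IsTestForm φ) :
    Continuous (classicalD φ) ∧ HasCompactSupport (classicalD φ) := by
  refine ⟨?_, ?_⟩
  · refine (PiLp.continuous_toLp 2 _).comp (continuous_pi fun I => ?_)
    exact continuous_finsetSum _ fun j _ =>
      continuous_const.mul (continuous_partialCoeff hφ _ _)
  · refine HasCompactSupport.intro hφ.2 fun x hx => ?_
    ext I
    simp [classicalD, partialCoeff_eq_zero hx]

variable {Ω : Set (EuclideanSpace ℝ (Fin n))}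

lemma exists_testPairing_eq {η : EuclideanSpace ℝ (Fin n) → FormVal n k}
    (h : Continuous η ∧ HasCompactSupport η) :
    ∃ y : L2Form Ω k, ∀ a : L2Form Ω k, testPairing a η = ⟪a, y⟫_ℝ := by
  have hm : MemLp η 2 (volume.restrict Ω) := h.1.memLp_of_hasCompactSupport h.2
  refine ⟨hm.toLp η, fun a => ?_⟩
  rw [L2.inner_def]
  refine integral_congr_ae ?_
  filter_upwards [hm.coeFn_toLp] with x hx
  rw [hx]

lemma testPairing_zero (η : EuclideanSpace ℝ (Fin n) → FormVal n k)
    (h : Continuous η ∧ HasCompactSupport η) : testPairing (0 : L2Form Ω k) η = 0 := by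
  obtain ⟨y, hy⟩ := exists_testPairing_eq (Ω := Ω) h
  rw [hy, inner_zero_left]

lemma testPairing_add {η : EuclideanSpace ℝ (Fin n) → FormVal n k}
    (h : Continuous η ∧ HasCompactSupport η) (a b : L2Form Ω k) :
    testPairing (a + b) η = testPairing a η + testPairing b η := by
  obtain ⟨y, hy⟩ := exists_testPairing_eq (Ω := Ω) h
  rw [hy, hy, hy, inner_add_left]

lemma testPairing_smul {η : EuclideanSpace ℝ (Fin n) → FormVal n k}
    (h : Continuous η ∧ HasCompactSupport η) (c : ℝ) (a : L2Form Ω k) :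
    testPairing (c • a) η = c * testPairing a η := by
  obtain ⟨y, hy⟩ := exists_testPairing_eq (Ω := Ω) h
  rw [hy, hy, real_inner_smul_left]

end helpers

/-! ### The spaces `HΛᵏ` and `H*Λᵏ`, traces -/

/-- Ambient Hilbert space of pairs `(a, b)` with `‖(a, b)‖² = ‖a‖² + ‖b‖²`. A form `a` of `HΛᵏ`
is represented by the pair `(a, d a)`, so that the norm of the pair is the `HΛᵏ`-norm of `a`. -/
abbrev FormPair {n : ℕ} (Ω : Set (EuclideanSpace ℝ (Fin n))) (k : ℕ) : Type :=
  WithLp 2 (L2Form Ω k × L2Form Ω (k + 1))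

/-- Pairs `(a, b)` with `∫_Ω (b, η) = ∫_Ω (a, d* η)` for all test `(k + 1)`-forms `η` whose
support does not meet the set `F`. -/
def greenSpace {n : ℕ} (Ω : Set (EuclideanSpace ℝ (Fin n))) (k : ℕ)
    (F : Set (EuclideanSpace ℝ (Fin n))) : Submodule ℝ (FormPair Ω k) where
  carrier := {x | ∀ η : EuclideanSpace ℝ (Fin n) → FormVal n (k + 1), IsTestForm η →
    Disjoint (tsupport η) F → testPairing x.snd η = testPairing x.fst (classicalCodiff η)}
  zero_mem' := fun η hη _ => by
    rw [WithLp.zero_snd, WithLp.zero_fst, testPairing_zero _ ⟨hη.1.continuous, hη.2⟩,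
      testPairing_zero _ hη.codiff]
  add_mem' := fun {x y} hx hy η hη hF => by
    rw [WithLp.add_snd, WithLp.add_fst, testPairing_add ⟨hη.1.continuous, hη.2⟩,
      testPairing_add hη.codiff, hx η hη hF, hy η hη hF]
  smul_mem' := fun c x hx η hη hF => by
    rw [WithLp.smul_snd, WithLp.smul_fst, testPairing_smul ⟨hη.1.continuous, hη.2⟩,
      testPairing_smul hη.codiff, hx η hη hF]

/-- `HΛᵏ(Ω)`: the pairs `(a, d a)` with `a ∈ L²Λᵏ(Ω)` whose weak exterior derivative `d a` on `Ω`
belongs to `L²Λᵏ⁺¹(Ω)` (test forms supported in `Ω`). -/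
def HForm {n : ℕ} (Ω : Set (EuclideanSpace ℝ (Fin n))) (k : ℕ) : Submodule ℝ (FormPair Ω k) :=
  greenSpace Ω k Ωᶜ

/-- The forms in `HΛᵏ(Ω)` with `tr a = 0` on the part `S` of the boundary, in the usual weak sense:
`(d a, η)_Ω = (a, d* η)_Ω` for all smooth `η` vanishing near the rest of the boundary. -/
def HFormTraceZero {n : ℕ} (Ω : Set (EuclideanSpace ℝ (Fin n))) (k : ℕ)
    (S : Set (EuclideanSpace ℝ (Fin n))) : Submodule ℝ (FormPair Ω k) :=
  HForm Ω k ⊓ greenSpace Ω k (frontier Ω \ S)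

/-- `H*Λᵏ⁺¹(Ω)`: the pairs `(d* b, b)` with `b ∈ L²Λᵏ⁺¹(Ω)` whose weak codifferential `d* b` on `Ω`
belongs to `L²Λᵏ(Ω)`, i.e. `(d φ, b)_Ω = (φ, d* b)_Ω` for all test forms `φ` supported in `Ω`. -/
def HStarForm {n : ℕ} (Ω : Set (EuclideanSpace ℝ (Fin n))) (k : ℕ) :
    Submodule ℝ (FormPair Ω k) where
  carrier := {x | ∀ φ : EuclideanSpace ℝ (Fin n) → FormVal n k, IsTestForm φ →
    tsupport φ ⊆ Ω → testPairing x.fst φ = testPairing x.snd (classicalD φ)}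
  zero_mem' := fun φ hφ _ => by
    rw [WithLp.zero_snd, WithLp.zero_fst, testPairing_zero _ ⟨hφ.1.continuous, hφ.2⟩,
      testPairing_zero _ hφ.d]
  add_mem' := fun {x y} hx hy φ hφ hF => by
    rw [WithLp.add_snd, WithLp.add_fst, testPairing_add ⟨hφ.1.continuous, hφ.2⟩,
      testPairing_add hφ.d, hx φ hφ hF, hy φ hφ hF]
  smul_mem' := fun c x hx φ hφ hF => by
    rw [WithLp.smul_snd, WithLp.smul_fst, testPairing_smul ⟨hφ.1.continuous, hφ.2⟩,
      testPairing_smul hφ.d, hx φ hφ hF]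

/-- `𝒵*,ᵏ⁺¹`: the forms `b ∈ L²Λᵏ⁺¹(Ω)` with `d* b = 0`. -/
def coclosedForms {n : ℕ} (Ω : Set (EuclideanSpace ℝ (Fin n))) (k : ℕ) :
    Submodule ℝ (L2Form Ω (k + 1)) :=
  Submodule.map (WithLp.sndₗ 2 ℝ (L2Form Ω k) (L2Form Ω (k + 1)))
    (HStarForm Ω k ⊓ LinearMap.ker (WithLp.fstₗ 2 ℝ (L2Form Ω k) (L2Form Ω (k + 1))))

/-- The boundary integral `∫_Γ tr a ∧ tr ⋆b` for `a ∈ HΛᵏ(Ω)` and `b ∈ H*Λᵏ⁺¹(Ω)`, defined by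
integration by parts as `(d a, b)_Ω - (a, d* b)_Ω`. The arguments are `(a, d a)` and `(d* b, b)`. -/
def boundaryPairing {n k : ℕ} {Ω : Set (EuclideanSpace ℝ (Fin n))} (a b : FormPair Ω k) : ℝ :=
  ⟪a.snd, b.snd⟫_ℝ - ⟪a.fst, b.fst⟫_ℝ

/-! ### The mixed vorticity-velocity-pressure problem -/

/-- The two decompositions `Γ = Γ_ω ∪ Γ_t` and `Γ = Γ_n ∪ Γ_π` of the boundary `Γ = ∂Ω`. -/
structure BoundaryDecomposition {n : ℕ} (Ω : Set (EuclideanSpace ℝ (Fin n))) where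
  /-- vanishing tangential vorticity -/
  Γω : Set (EuclideanSpace ℝ (Fin n))
  /-- prescribed tangential velocity -/
  Γt : Set (EuclideanSpace ℝ (Fin n))
  /-- vanishing normal velocity -/
  Γn : Set (EuclideanSpace ℝ (Fin n))
  /-- prescribed pressure plus divergence of velocity -/
  Γp : Set (EuclideanSpace ℝ (Fin n))
  union_ωt : Γω ∪ Γt = frontier Ω
  disjoint_ωt : Disjoint Γω Γt
  union_np : Γn ∪ Γp = frontier Ω
  disjoint_np : Disjoint Γn Γp

section problem

variable {m : ℕ} {Ω : Set (EuclideanSpace ℝ (Fin (m + 2)))}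

/-- `𝖺(τ, κ) = (τ, κ)_Ω`. -/
def formA (τ κ : FormPair Ω m) : ℝ := ⟪τ.fst, κ.fst⟫_ℝ

/-- `𝖻(v, q) = (d v, q)_Ω`. -/
def formB (v : FormPair Ω (m + 1)) (q : L2Form Ω (m + 2)) : ℝ := ⟪v.snd, q⟫_ℝ

/-- `𝖼(τ, v) = (d τ, v)_Ω`. -/
def formC (τ : FormPair Ω m) (v : FormPair Ω (m + 1)) : ℝ := ⟪τ.snd, v.fst⟫_ℝ

/-- `𝖾(v, w) = (d v, d w)_Ω`. -/
def formE (v w : FormPair Ω (m + 1)) : ℝ := ⟪v.snd, w.snd⟫_ℝ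

/-- The vorticity space `W`: the `(n - 2)`-forms in `HΛⁿ⁻²(Ω)` with `tr τ = 0` on `Γ_ω`. -/
def spaceW (D : BoundaryDecomposition Ω) : Submodule ℝ (FormPair Ω m) :=
  HFormTraceZero Ω m D.Γω

/-- The `(n - 1)`-forms in `HΛⁿ⁻¹(Ω)` with `tr v = 0` on `Γ_n`. -/
def spaceVfull (D : BoundaryDecomposition Ω) : Submodule ℝ (FormPair Ω (m + 1)) :=
  HFormTraceZero Ω (m + 1) D.Γn

/-- The velocity fields `z` with `d z = 0` and `d* z = 0`, the latter in the form
`(d τ, z)_Ω = 0` for all `τ ∈ W`: the ambiguity of the velocity in the mixed problem. -/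
def nullVelocities (D : BoundaryDecomposition Ω) : Submodule ℝ (FormPair Ω (m + 1)) where
  carrier := {z | z ∈ spaceVfull D ∧ z.snd = 0 ∧ ∀ τ ∈ spaceW D, formC τ z = 0}
  zero_mem' := ⟨Submodule.zero_mem _, rfl, fun τ _ => by simp [formC]⟩
  add_mem' := fun {x y} hx hy => ⟨Submodule.add_mem _ hx.1 hy.1, by
      rw [WithLp.add_snd, hx.2.1, hy.2.1, add_zero], fun τ hτ => by
      have h1 := hx.2.2 τ hτ
      have h2 := hy.2.2 τ hτ
      simp only [formC] at h1 h2 ⊢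
      rw [WithLp.add_fst, inner_add_right, h1, h2, add_zero]⟩
  smul_mem' := fun c x hx => ⟨Submodule.smul_mem _ c hx.1, by
      rw [WithLp.smul_snd, hx.2.1, smul_zero], fun τ hτ => by
      have h1 := hx.2.2 τ hτ
      simp only [formC] at h1 ⊢
      rw [WithLp.smul_fst, real_inner_smul_right, h1, mul_zero]⟩

open Classical in
/-- The velocity space `V`. If `Γ₄ = Γ_ω ∩ Γ_π` is nonempty, the velocity is only determined modulo
`nullVelocities`, and the quotient is represented by the orthogonal complement. -/
def spaceV (D : BoundaryDecomposition Ω) : Submodule ℝ (FormPair Ω (m + 1)) :=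
  if D.Γω ∩ D.Γp = ∅ then spaceVfull D else spaceVfull D ⊓ (nullVelocities D)ᗮ

open Classical in
/-- The pressure space `Q`: all of `L²Λⁿ(Ω)` if `Γ_π ≠ ∅`; otherwise the quotient by
`𝒵*,ⁿ` (the constants), represented by the orthogonal complement (pressures of zero average). -/
def spaceQ (D : BoundaryDecomposition Ω) : Submodule ℝ (L2Form Ω (m + 2)) :=
  if D.Γp = ∅ then (coclosedForms Ω (m + 1))ᗮ else ⊤

/-- `Z_V = {v ∈ V | d v = 0}`; likewise `Z_W`. -/
def nullSpace {k : ℕ} (X : Submodule ℝ (FormPair Ω k)) : Submodule ℝ (FormPair Ω k) :=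
  X ⊓ LinearMap.ker (WithLp.sndₗ 2 ℝ (L2Form Ω k) (L2Form Ω (k + 1)))

/-- Data of the problem: the right-hand sides `f`, `g` and the natural boundary data
`u_{b,t}` on `Γ_t`, `Π_b` on `Γ_π`. The boundary data are given by forms on `Ω` attaining them,
`tr ⋆β = u_{b,t}` on `Γ_t` and `tr ⋆ρ = Π_b` on `Γ_π`, where `β ∈ H*Λⁿ⁻¹(Ω)` and `ρ ∈ H*Λⁿ(Ω)` are
stored as `(d* β, β)` and `(d* ρ, ρ)`; all data of class `H^{1/2}` arise in this way, from liftings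
of class `H¹`. -/
structure StokesData (Ω : Set (EuclideanSpace ℝ (Fin (m + 2)))) where
  f : L2Form Ω (m + 1)
  g : L2Form Ω (m + 2)
  β : FormPair Ω m
  hβ : β ∈ HStarForm Ω m
  ρ : FormPair Ω (m + 1)
  hρ : ρ ∈ HStarForm Ω (m + 1)

/-- `𝖿(v) = (v, f)_Ω + ∫_{Γ_π} tr v ∧ Π_b`, where the integral over `Γ_n` vanishes as `tr v = 0`
there. -/
def StokesData.functionalF (𝒟 : StokesData Ω) (v : FormPair Ω (m + 1)) : ℝ :=
  ⟪v.fst, 𝒟.f⟫_ℝ + boundaryPairing v 𝒟.ρ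

/-- `𝗀(q) = (q, g)_Ω`. -/
def StokesData.functionalG (𝒟 : StokesData Ω) (q : L2Form Ω (m + 2)) : ℝ := ⟪q, 𝒟.g⟫_ℝ

/-- `𝗁(τ) = -∫_{Γ_t} tr τ ∧ u_{b,t}`, where the integral over `Γ_ω` vanishes as `tr τ = 0`
there. -/
def StokesData.functionalH (𝒟 : StokesData Ω) (τ : FormPair Ω m) : ℝ := -boundaryPairing τ 𝒟.β

/-- `(ω, u, p) ∈ X × Y × P` solves the mixed problem with test functions in `X × Y × P`. For the
spaces `W`, `V`, `Q` this is the continuous problem, for `W_h`, `V_h`, `Q_h` the discrete one. -/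
structure IsMixedSolution (𝒟 : StokesData Ω) (X : Submodule ℝ (FormPair Ω m))
    (Y : Submodule ℝ (FormPair Ω (m + 1))) (P : Submodule ℝ (L2Form Ω (m + 2)))
    (ω : FormPair Ω m) (u : FormPair Ω (m + 1)) (p : L2Form Ω (m + 2)) : Prop where
  mem_ω : ω ∈ X
  mem_u : u ∈ Y
  mem_p : p ∈ P
  eq_vorticity : ∀ τ ∈ X, formA τ ω - formC τ u = 𝒟.functionalH τ
  eq_momentum : ∀ v ∈ Y, formE v u + formC ω v + formB v p = 𝒟.functionalF v
  eq_mass : ∀ q ∈ P, formB u q = 𝒟.functionalG q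

/-- `Z_{V_h}`: the discrete velocities `v` with `𝖻(v, q) = 0` for all discrete pressures `q`. -/
def discreteZV (Vh : Submodule ℝ (FormPair Ω (m + 1))) (Qh : Submodule ℝ (L2Form Ω (m + 2))) :
    Submodule ℝ (FormPair Ω (m + 1)) where
  carrier := {v | v ∈ Vh ∧ ∀ q ∈ Qh, formB v q = 0}
  zero_mem' := ⟨Submodule.zero_mem _, fun q _ => by simp [formB]⟩
  add_mem' := fun {x y} hx hy => ⟨Submodule.add_mem _ hx.1 hy.1, fun q hq => by
      have h1 := hx.2 q hq
      have h2 := hy.2 q hq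
      simp only [formB] at h1 h2 ⊢
      rw [WithLp.add_snd, inner_add_left, h1, h2, add_zero]⟩
  smul_mem' := fun c x hx => ⟨Submodule.smul_mem _ c hx.1, fun q hq => by
      have h1 := hx.2 q hq
      simp only [formB] at h1 ⊢
      rw [WithLp.smul_snd, real_inner_smul_left, h1, mul_zero]⟩

/-- `Z_{W_h}`: the discrete vorticities `τ` with `𝖼(τ, v) = 0` for all `v ∈ Z_{V_h}`. -/
def discreteZW (Wh : Submodule ℝ (FormPair Ω m)) (ZVh : Submodule ℝ (FormPair Ω (m + 1))) :
    Submodule ℝ (FormPair Ω m) where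
  carrier := {τ | τ ∈ Wh ∧ ∀ v ∈ ZVh, formC τ v = 0}
  zero_mem' := ⟨Submodule.zero_mem _, fun q _ => by simp [formC]⟩
  add_mem' := fun {x y} hx hy => ⟨Submodule.add_mem _ hx.1 hy.1, fun v hv => by
      have h1 := hx.2 v hv
      have h2 := hy.2 v hv
      simp only [formC] at h1 h2 ⊢
      rw [WithLp.add_snd, inner_add_left, h1, h2, add_zero]⟩
  smul_mem' := fun c x hx => ⟨Submodule.smul_mem _ c hx.1, fun v hv => by
      have h1 := hx.2 v hv
      simp only [formC] at h1 ⊢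
      rw [WithLp.smul_snd, real_inner_smul_left, h1, mul_zero]⟩

end problem

/-- The inf-sup condition `inf_{0 ≠ x ∈ S} sup_{0 ≠ y ∈ T} B(x, y) / (‖x‖ ‖y‖) ≥ γ`, for bounded
bilinear forms `B` and `γ > 0`. -/
def InfSupGE {X Y : Type*} [NormedAddCommGroup X] [NormedSpace ℝ X] [NormedAddCommGroup Y]
    [NormedSpace ℝ Y] (B : X → Y → ℝ) (S : Submodule ℝ X) (T : Submodule ℝ Y) (γ : ℝ) : Prop :=
  ∀ x ∈ S, x ≠ 0 → γ ≤ sSup {r : ℝ | ∃ y ∈ T, y ≠ 0 ∧ r = B x y / (‖x‖ * ‖y‖)}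

end StokesVVP

end

namespace StokesVVP

/-! ### Consequences of an inf-sup condition -/

section InfSup

variable {X Y : Type*} [NormedAddCommGroup X] [NormedAddCommGroup Y]

/-! Subtracting the discrete equations from the continuous ones gives Galerkin orthogonality, and
compatibility decouples the errors. The mass equation makes `u - uh` `𝖻`-orthogonal to `Qh`; since
`d Vh ⊆ Qh`, the `𝖾`-term of the momentum error vanishes. Elements of `Z_{V_h}` and `Z_{W_h}` are
truly closed, so testing with them removes the pressure error from the momentum equation and the
velocity error from the vorticity equation. The errors can therefore be estimated in the order `ω`,
then `u` and `p` separately, each of the latter two affected only by the error of `ω`.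

For `ω` and `u`, an arbitrary discrete competitor is first corrected to satisfy the constraint of
the discrete solution. The correction exists and is bounded by `InfSupGE.exists_represents`: an
inf-sup condition makes the transposed problem solvable with norm at most `1/γ` times that of the
data. The difference from the discrete solution then lies in a discrete kernel, where
`InfSupGE.mul_norm_le` bounds it. Each factor `1 + c/γ` is one triangle inequality. -/

lemma InfSupGE.mul_norm_le [NormedSpace ℝ X] [NormedSpace ℝ Y] {B : X → Y → ℝ}
    {S : Submodule ℝ X} {T : Submodule ℝ Y} {γ : ℝ} (h : InfSupGE B S T γ)
    {x : X} (hx : x ∈ S) {M : ℝ} (hM : 0 ≤ M) (hB : ∀ y ∈ T, B x y ≤ M * ‖y‖) :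
    γ * ‖x‖ ≤ M := by
  rcases eq_or_ne x 0 with rfl | hx0
  · simpa using hM
  have hxpos : 0 < ‖x‖ := norm_pos_iff.2 hx0
  -- If `T` is trivial the supremum is over the empty set and equals `0`; this case uses `0 ≤ M`.
  refine (le_div_iff₀ hxpos).1 ((h x hx hx0).trans (Real.sSup_le ?_ (by positivity)))
  rintro r ⟨y, hy, hy0, rfl⟩
  have hypos : 0 < ‖y‖ := norm_pos_iff.2 hy0
  rw [div_le_div_iff₀ (by positivity) hxpos]
  nlinarith [hB y hy]

/-- Under the inf-sup condition, every bounded functional on the finite-dimensional space `S` is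
represented by an element of `T`, with control of the norm. -/
lemma InfSupGE.exists_represents [InnerProductSpace ℝ X] [InnerProductSpace ℝ Y]
    (B : X →ₗ[ℝ] Y →ₗ[ℝ] ℝ) {S : Submodule ℝ X} {T : Submodule ℝ Y}
    [FiniteDimensional ℝ S] [FiniteDimensional ℝ T] {γ : ℝ}
    (h : InfSupGE (fun x y => B x y) S T γ) (hγ : 0 < γ) (l : X →ₗ[ℝ] ℝ) {M : ℝ} (hM : 0 ≤ M)
    (hl : ∀ x ∈ S, l x ≤ M * ‖x‖) :
    ∃ y ∈ T, (∀ x ∈ S, B x y = l x) ∧ γ * ‖y‖ ≤ M := by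
  obtain ⟨A, hA⟩ : ∃ A : S →ₗ[ℝ] T, ∀ (x : S) (y : T), ⟪A x, y⟫_ℝ = B x y := by
    have hR : ∀ (x : S) (y : T), ⟪(InnerProductSpace.toDual ℝ T).symm
        (LinearMap.toContinuousLinearMap ((B x).domRestrict T)), y⟫_ℝ = B x y := fun x y => by
      rw [InnerProductSpace.toDual_symm_apply]
      rfl
    exact ⟨{ toFun := fun x => (InnerProductSpace.toDual ℝ T).symm
               (LinearMap.toContinuousLinearMap ((B x).domRestrict T))
             map_add' := fun x x' => ext_inner_right ℝ fun y => by
               rw [inner_add_left, hR, hR, hR, Submodule.coe_add, map_add, LinearMap.add_apply]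
             map_smul' := fun c x => ext_inner_right ℝ fun y => by
               rw [RingHom.id_apply, real_inner_smul_left, hR, hR, Submodule.coe_smul, map_smul,
                 LinearMap.smul_apply, smul_eq_mul] }, hR⟩
  have hAlow : ∀ x : S, γ * ‖x‖ ≤ ‖A x‖ := fun x =>
    h.mul_norm_le x.2 (norm_nonneg _) fun y hy =>
      (hA x ⟨y, hy⟩).symm.le.trans (real_inner_le_norm _ _)
  -- With `A` the Riesz representation of `B`, `G` is the normal operator `A*A`. It is injective
  -- because `A` is bounded below, hence onto the dual by dimension count; `y = A w` solves the
  -- problem.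
  let G : S →ₗ[ℝ] Module.Dual ℝ S := (B.domRestrict S).flip ∘ₗ T.subtype ∘ₗ A
  have hG : ∀ w x : S, G w x = ⟪A x, A w⟫_ℝ := fun w x => (hA x (A w)).symm
  have hGinj : Function.Injective G := by
    refine (injective_iff_map_eq_zero G).2 fun w hw => ?_
    have h0 : A w = 0 := by
      rw [← inner_self_eq_zero (𝕜 := ℝ), ← hG, hw, LinearMap.zero_apply]
    have h1 := hAlow w
    rw [h0, norm_zero] at h1
    exact norm_le_zero_iff.1 (nonpos_of_mul_nonpos_right h1 hγ)
  obtain ⟨w, hw⟩ := (LinearMap.injective_iff_surjective_of_finrank_eq_finrank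
    (Subspace.dual_finrank_eq (K := ℝ) (V := S)).symm).1 hGinj (l.domRestrict S)
  have hwx : ∀ x : S, ⟪A x, A w⟫_ℝ = l x := fun x => by
    rw [← hG, hw]
    rfl
  refine ⟨A w, (A w).2, fun x hx => (hA ⟨x, hx⟩ (A w)).symm.trans (hwx ⟨x, hx⟩), ?_⟩
  -- Testing with `w` itself gives `‖A w‖² = l w ≤ M ‖w‖`; one use of the lower bound on `A` then
  -- yields the constant `1/γ` rather than `1/γ²`.
  have h2 : ‖A w‖ * ‖A w‖ ≤ M * ‖w‖ := by
    rw [← real_inner_self_eq_norm_mul_norm, hwx]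
    exact hl w w.2
  rcases (norm_nonneg (A w)).eq_or_lt with h0 | hpos
  · rw [← Submodule.coe_norm, ← h0, mul_zero]
    exact hM
  · refine le_of_mul_le_mul_right ?_ hpos
    calc γ * ‖A w‖ * ‖A w‖ = γ * (‖A w‖ * ‖A w‖) := mul_assoc _ _ _
      _ ≤ γ * (M * ‖w‖) := by gcongr
      _ = M * (γ * ‖w‖) := by ring
      _ ≤ M * ‖A w‖ := by gcongr; exact hAlow w

lemma le_mul_ciInf_norm_sub [NormedSpace ℝ X] {S : Submodule ℝ X} {x : X} {a K : ℝ} (hK : 0 ≤ K)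
    (h : ∀ y ∈ S, a ≤ K * ‖x - y‖) : a ≤ K * ⨅ y : S, ‖x - y‖ := by
  rw [Real.mul_iInf_of_nonneg hK]
  exact le_ciInf fun y => h y y.2

end InfSup

/-! ### Bilinearity of the forms -/

section forms

variable {m : ℕ} {Ω : Set (EuclideanSpace ℝ (Fin (m + 2)))}

/-- The form `𝖼` as a bilinear map with the velocity as first argument. -/
noncomputable def bilinC : FormPair Ω (m + 1) →ₗ[ℝ] FormPair Ω m →ₗ[ℝ] ℝ :=
  LinearMap.mk₂ ℝ (fun v τ => formC τ v)
    (fun v v' τ => by simp [formC, inner_add_right])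
    (fun c v τ => by simp [formC, real_inner_smul_right])
    (fun v τ τ' => by simp [formC, inner_add_left])
    (fun c v τ => by simp [formC, real_inner_smul_left])

/-- The form `𝖻` as a bilinear map with the pressure as first argument. -/
noncomputable def bilinB : L2Form Ω (m + 2) →ₗ[ℝ] FormPair Ω (m + 1) →ₗ[ℝ] ℝ :=
  LinearMap.mk₂ ℝ (fun q v => formB v q)
    (fun v v' τ => by simp [formB, inner_add_right])
    (fun c v τ => by simp [formB, real_inner_smul_right])
    (fun v τ τ' => by simp [formB, inner_add_left])
    (fun c v τ => by simp [formB, real_inner_smul_left])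

lemma formA_sub_right (τ κ κ' : FormPair Ω m) : formA τ (κ - κ') = formA τ κ - formA τ κ' := by
  simp [formA, inner_sub_right]

lemma formA_comm (τ κ : FormPair Ω m) : formA τ κ = formA κ τ := real_inner_comm _ _

lemma formB_sub_left (v v' : FormPair Ω (m + 1)) (q : L2Form Ω (m + 2)) :
    formB (v - v') q = formB v q - formB v' q := by
  simp [formB, inner_sub_left]

lemma formB_sub_right (v : FormPair Ω (m + 1)) (q q' : L2Form Ω (m + 2)) :
    formB v (q - q') = formB v q - formB v q' := by
  simp [formB, inner_sub_right]

lemma formC_sub_left (τ τ' : FormPair Ω m) (v : FormPair Ω (m + 1)) :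
    formC (τ - τ') v = formC τ v - formC τ' v := by
  simp [formC, inner_sub_left]

lemma formC_sub_right (τ : FormPair Ω m) (v v' : FormPair Ω (m + 1)) :
    formC τ (v - v') = formC τ v - formC τ v' := by
  simp [formC, inner_sub_right]

/-- This lets the mass equation, tested with `q = d v`, cancel the `𝖾`-term. -/
lemma formE_eq_formB (v w : FormPair Ω (m + 1)) : formE v w = formB w v.snd :=
  real_inner_comm _ _

lemma snd_eq_zero_of_mem_nullSpace {k : ℕ} {X : Submodule ℝ (FormPair Ω k)} {x : FormPair Ω k}
    (hx : x ∈ nullSpace X) : x.snd = 0 := hx.2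

end forms

end StokesVVP

/-! ### The error estimates -/

open StokesVVP in
theorem theorem5p1 {m : ℕ} (Ω : Set (EuclideanSpace ℝ (Fin (m + 2))))
    (hΩo : IsOpen Ω) (hΩb : Bornology.IsBounded Ω) (hΩc : ContractibleSpace Ω)
    (D : BoundaryDecomposition Ω) (𝒟 : StokesData Ω)
    -- the conforming discrete spaces
    (Wh : Submodule ℝ (FormPair Ω m)) (Vh : Submodule ℝ (FormPair Ω (m + 1)))
    (Qh : Submodule ℝ (L2Form Ω (m + 2)))
    [FiniteDimensional ℝ Wh] [FiniteDimensional ℝ Vh] [FiniteDimensional ℝ Qh]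
    (hWh : Wh ≤ spaceW D) (hVh : Vh ≤ spaceV D) (hQh : Qh ≤ spaceQ D)
    -- compatibility
    (hZW : discreteZW Wh (discreteZV Vh Qh) ≤ nullSpace (spaceW D))
    (hZV : discreteZV Vh Qh ≤ nullSpace (spaceV D))
    (hdV : ∀ q, q ∈ Qh ↔ ∃ v ∈ Vh, v.snd = q)
    -- continuity constants
    (ca cb cc ce : ℝ) (hca : 0 < ca) (hcb : 0 < cb) (hcc : 0 < cc) (hce : 0 < ce)
    (ha : ∀ τ ∈ spaceW D, ∀ κ ∈ spaceW D, formA τ κ ≤ ca * ‖τ‖ * ‖κ‖)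
    (hb : ∀ v ∈ spaceV D, ∀ q ∈ spaceQ D, formB v q ≤ cb * ‖v‖ * ‖q‖)
    (hc : ∀ τ ∈ spaceW D, ∀ v ∈ spaceV D, formC τ v ≤ cc * ‖τ‖ * ‖v‖)
    (he : ∀ v ∈ spaceV D, ∀ w ∈ spaceV D, formE v w ≤ ce * ‖v‖ * ‖w‖)
    -- discrete inf-sup constants; the form `formA` is symmetric
    (αh βh γh : ℝ) (hα : 0 < αh) (hβ : 0 < βh) (hγ : 0 < γh)
    (hinfA : InfSupGE formA (discreteZW Wh (discreteZV Vh Qh))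
      (discreteZW Wh (discreteZV Vh Qh)) αh)
    (hinfB : InfSupGE (fun (q : L2Form Ω (m + 2)) (v : FormPair Ω (m + 1)) => formB v q) Qh Vh βh)
    (hinfC : InfSupGE (fun (v : FormPair Ω (m + 1)) (τ : FormPair Ω m) => formC τ v)
      (discreteZV Vh Qh) Wh γh)
    -- the continuous and the discrete solution
    (ω ωh : FormPair Ω m) (u uh : FormPair Ω (m + 1)) (p ph : L2Form Ω (m + 2))
    (hsol : IsMixedSolution 𝒟 (spaceW D) (spaceV D) (spaceQ D) ω u p)
    (hsolh : IsMixedSolution 𝒟 Wh Vh Qh ωh uh ph) :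
    ‖ω - ωh‖ ≤ (1 + ca / αh) * (1 + cc / γh) * (⨅ τ : Wh, ‖ω - τ‖) ∧
    ‖u - uh‖ ≤ (1 + cc / γh) * (1 + cb / βh) * (⨅ v : Vh, ‖u - v‖)
      + ca / γh * (1 + ca / αh) * (1 + cc / γh) * (⨅ τ : Wh, ‖ω - τ‖) ∧
    ‖p - ph‖ ≤ (1 + cb / βh) * (⨅ q : Qh, ‖p - q‖)
      + ce / βh * (1 + cc / γh) * (1 + cb / βh) * (⨅ v : Vh, ‖u - v‖)
      + (ca / γh + cc / βh) * (1 + ca / αh) * (1 + cc / γh) * (⨅ τ : Wh, ‖ω - τ‖) := by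
  have : FiniteDimensional ℝ (discreteZV Vh Qh) :=
    Submodule.finiteDimensional_of_le (S₂ := Vh) fun _ hv => hv.1
  -- Vanishing against every `v`, not only discrete ones, is what allows testing against the error
  -- `u - uh`.
  have hzτ : ∀ τ ∈ discreteZW Wh (discreteZV Vh Qh), ∀ v, formC τ v = 0 := fun τ hτ v => by
    rw [formC, snd_eq_zero_of_mem_nullSpace (hZW hτ), inner_zero_left]
  have hzv : ∀ v ∈ discreteZV Vh Qh, ∀ q, formB v q = 0 := fun v hv q => by
    rw [formB, snd_eq_zero_of_mem_nullSpace (hZV hv), inner_zero_left]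
  -- Galerkin orthogonality
  have g1 : ∀ τ ∈ Wh, formA τ (ω - ωh) = formC τ (u - uh) := fun τ hτ => by
    have h1 := hsol.eq_vorticity τ (hWh hτ)
    have h2 := hsolh.eq_vorticity τ hτ
    rw [formA_sub_right, formC_sub_right]
    linarith
  have g3 : ∀ q ∈ Qh, formB (u - uh) q = 0 := fun q hq => by
    rw [formB_sub_left, hsol.eq_mass q (hQh hq), hsolh.eq_mass q hq, sub_self]
  -- the term with `formE` drops out because `d Vh ⊆ Qh`
  have g2 : ∀ v ∈ Vh, formC (ω - ωh) v + formB v (p - ph) = 0 := fun v hv => by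
    have h1 := hsol.eq_momentum v (hVh hv)
    have h2 := hsolh.eq_momentum v hv
    have h3 := g3 v.snd ((hdV _).2 ⟨v, hv, rfl⟩)
    rw [formE_eq_formB] at h1 h2
    rw [formB_sub_left] at h3
    rw [formC_sub_left, formB_sub_right]
    linarith
  have hω : ∀ τ ∈ Wh, ‖ω - ωh‖ ≤ (1 + ca / αh) * (1 + cc / γh) * ‖ω - τ‖ := fun τ hτ => by
    have hτW : ω - τ ∈ spaceW D := sub_mem hsol.mem_ω (hWh hτ)
    -- The correction `r` makes `τ + r` agree with `ω` under `𝖼` on `Z_{V_h}`, as `ωh` does; hence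
    -- `ωh - (τ + r)` lies in `Z_{W_h}`.
    obtain ⟨r, hr, hrv, hrn⟩ := InfSupGE.exists_represents bilinC hinfC hγ (bilinC.flip (ω - τ))
      (M := cc * ‖ω - τ‖) (by positivity) fun v hv => hc _ hτW _ (hZV hv).1
    replace hrv : ∀ v ∈ discreteZV Vh Qh, formC r v = formC (ω - τ) v := hrv
    have hmem : ωh - (τ + r) ∈ discreteZW Wh (discreteZV Vh Qh) := by
      refine ⟨sub_mem hsolh.mem_ω (add_mem hτ hr), fun v hv => ?_⟩
      have h1 := g2 v hv.1
      have h2 := hrv v hv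
      rw [hzv v hv, add_zero, formC_sub_left] at h1
      rw [formC_sub_left] at h2
      rw [← sub_sub, formC_sub_left, formC_sub_left]
      linarith
    have h1 : αh * ‖ωh - (τ + r)‖ ≤ ca * ‖ω - (τ + r)‖ := by
      refine hinfA.mul_norm_le hmem (by positivity) fun κ hκ => ?_
      have h2 := g1 κ hκ.1
      rw [hzτ κ hκ, formA_sub_right] at h2
      have h3 := ha κ (hWh hκ.1) (ω - (τ + r)) (sub_mem hsol.mem_ω (hWh (add_mem hτ hr)))
      rw [formA_comm, formA_sub_right]
      rw [formA_sub_right] at h3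
      linarith
    have h2 : ‖r‖ ≤ cc / γh * ‖ω - τ‖ := by
      rw [div_mul_eq_mul_div, le_div_iff₀' hγ]
      exact hrn
    have h3 : ‖ωh - (τ + r)‖ ≤ ca / αh * ‖ω - (τ + r)‖ := by
      rw [div_mul_eq_mul_div, le_div_iff₀' hα]
      exact h1
    calc ‖ω - ωh‖ ≤ ‖ω - (τ + r)‖ + ‖ωh - (τ + r)‖ := by
          simpa only [dist_eq_norm] using dist_triangle_right ω ωh (τ + r)
      _ ≤ (1 + ca / αh) * ‖ω - (τ + r)‖ := by linarith
      _ ≤ (1 + ca / αh) * (‖ω - τ‖ + ‖r‖) := by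
        gcongr
        rw [← sub_sub]
        exact norm_sub_le _ _
      _ ≤ (1 + ca / αh) * (‖ω - τ‖ + cc / γh * ‖ω - τ‖) := by gcongr
      _ = _ := by ring
  -- The vorticity error stays on the left so that the infimum over `v` can be taken independently
  -- of `τ`.
  have hu : ∀ v ∈ Vh, ‖u - uh‖ - ca / γh * ‖ω - ωh‖
      ≤ (1 + cc / γh) * (1 + cb / βh) * ‖u - v‖ := fun v hv => by
    have hvV : u - v ∈ spaceV D := sub_mem hsol.mem_u (hVh hv)
    obtain ⟨r, hr, hrq, hrn⟩ := InfSupGE.exists_represents bilinB hinfB hβ (bilinB.flip (u - v))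
      (M := cb * ‖u - v‖) (by positivity) fun q hq => hb _ hvV _ (hQh hq)
    replace hrq : ∀ q ∈ Qh, formB r q = formB (u - v) q := hrq
    have hmem : uh - (v + r) ∈ discreteZV Vh Qh := by
      refine ⟨sub_mem hsolh.mem_u (add_mem hv hr), fun q hq => ?_⟩
      have h1 := g3 q hq
      have h2 := hrq q hq
      rw [formB_sub_left] at h1 h2
      rw [← sub_sub, formB_sub_left, formB_sub_left]
      linarith
    have h1 : γh * ‖uh - (v + r)‖ ≤ ca * ‖ω - ωh‖ + cc * ‖u - (v + r)‖ := by
      refine hinfC.mul_norm_le hmem (by positivity) fun τ hτ => ?_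
      have h2 := g1 τ hτ
      have h3 := hc τ (hWh hτ) (u - (v + r)) (sub_mem hsol.mem_u (hVh (add_mem hv hr)))
      -- `𝖺(τ, ω - ωh)` enters with a minus sign and continuity is one-sided, hence the reversed
      -- difference.
      have h4 := ha τ (hWh hτ) (ωh - ω) (sub_mem (hWh hsolh.mem_ω) hsol.mem_ω)
      rw [norm_sub_rev] at h4
      rw [formA_sub_right] at h2 h4
      rw [formC_sub_right] at h2 h3 ⊢
      linarith
    have h2 : ‖r‖ ≤ cb / βh * ‖u - v‖ := by
      rw [div_mul_eq_mul_div, le_div_iff₀' hβ]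
      exact hrn
    have h3 : ‖uh - (v + r)‖ ≤ ca / γh * ‖ω - ωh‖ + cc / γh * ‖u - (v + r)‖ := by
      rw [div_mul_eq_mul_div, div_mul_eq_mul_div, ← add_div, le_div_iff₀' hγ]
      exact h1
    calc ‖u - uh‖ - ca / γh * ‖ω - ωh‖
        ≤ ‖u - (v + r)‖ + ‖uh - (v + r)‖ - ca / γh * ‖ω - ωh‖ := by
          gcongr
          simpa only [dist_eq_norm] using dist_triangle_right u uh (v + r)
      _ ≤ (1 + cc / γh) * ‖u - (v + r)‖ := by linarith
      _ ≤ (1 + cc / γh) * (‖u - v‖ + ‖r‖) := by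
        gcongr
        rw [← sub_sub]
        exact norm_sub_le _ _
      _ ≤ (1 + cc / γh) * (‖u - v‖ + cb / βh * ‖u - v‖) := by gcongr
      _ = _ := by ring
  -- No correction is needed: `ph - q` already lies in `Qh`, where the inf-sup condition for `𝖻`
  -- applies.
  have hp : ∀ q ∈ Qh, ‖p - ph‖ - cc / βh * ‖ω - ωh‖ ≤ (1 + cb / βh) * ‖p - q‖ := fun q hq => by
    have h1 : βh * ‖ph - q‖ ≤ cb * ‖p - q‖ + cc * ‖ω - ωh‖ := by
      refine hinfB.mul_norm_le (sub_mem hsolh.mem_p hq) (by positivity) fun v hv => ?_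
      have h2 := g2 v hv
      have h3 := hb v (hVh hv) (p - q) (sub_mem hsol.mem_p (hQh hq))
      have h4 := hc (ω - ωh) (sub_mem hsol.mem_ω (hWh hsolh.mem_ω)) v (hVh hv)
      rw [formB_sub_right] at h2 h3 ⊢
      linarith
    have h2 : ‖ph - q‖ ≤ cb / βh * ‖p - q‖ + cc / βh * ‖ω - ωh‖ := by
      rw [div_mul_eq_mul_div, div_mul_eq_mul_div, ← add_div, le_div_iff₀' hβ]
      exact h1
    have h3 : ‖p - ph‖ ≤ ‖p - q‖ + ‖ph - q‖ := by
      simpa only [dist_eq_norm] using dist_triangle_right p ph q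
    linarith
  have Hω := le_mul_ciInf_norm_sub (K := (1 + ca / αh) * (1 + cc / γh)) (by positivity) hω
  have Hu := le_mul_ciInf_norm_sub (K := (1 + cc / γh) * (1 + cb / βh)) (by positivity) hu
  have Hp := le_mul_ciInf_norm_sub (K := 1 + cb / βh) (by positivity) hp
  have hV0 : 0 ≤ ⨅ v : Vh, ‖u - v‖ := Real.iInf_nonneg fun v => norm_nonneg _
  have hWu := mul_le_mul_of_nonneg_left Hω (show 0 ≤ ca / γh by positivity)
  have hWp := mul_le_mul_of_nonneg_left Hω (show 0 ≤ cc / βh by positivity)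
  -- The pressure bound just obtained has neither the velocity term nor the `ca / γh` term; both are
  -- nonnegative and may be added.
  have hW0 : 0 ≤ ca / γh * ‖ω - ωh‖ := by positivity
  have hE0 : 0 ≤ ce / βh * (1 + cc / γh) * (1 + cb / βh) * (⨅ v : Vh, ‖u - v‖) := by positivity
  refine ⟨Hω, ?_, ?_⟩
  · linarith
  · linarith
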